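/- Let $X$ be a compact totally disconnected Abelian group of the form $X=\prod_{p\in\mathcal P}X_p$ (direct product with the product topology), where $\mathcal P$ is a set of primes with $2\notin\mathcal P$, and each $X_p$ is either the finite cyclic group $\mathbb Z(p^{k_p})$ of order $p^{k_p}$ or the group $\mathbb Z_p$ of $p$-adic integers. Let $\alpha$ be a topological automorphism of $X$, and let $I$ be the identity automorphism. Let $\xi_1,\xi_2$ be independent random variables with values in $X$ and distributions $\mu_1,\mu_2$. Assume that the conditional distribution of $L_2=\xi_1+\alpha\xi_2$ given $L_1=\xi_1+\xi_2$ is symmetric, i.e. the random vectors $(L_1,L_2)$ and $(L_1,-L_2)$ are identically distributed. Then there are a compact subgroup $G$ of $X$ with $(I-\alpha)(G)=G$ and a probability distribution $\lambda$ on $X$ supported in $G$ such that: (i) $\mu_1$ and $\mu_2$ are shifts of $\lambda$, i.e. $\mu_j=\lambda*E_{x_j}$ for some $x_j\in X$, where $E_x$ is the distribution concentrated at $x$; (ii) $G$ is the smallest closed subgroup of $X$ containing the support of $\lambda$; (iii) the Haar distribution $m_{(I+\alpha)(G)}$ (the normalized Haar measure of the compact group $(I+\alpha)(G)$, viewed as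 a distribution on $X$) is a factor of $\lambda$, i.e. $\lambda=m_{(I+\alpha)(G)}*\nu$ for some probability distribution $\nu$ on $X$; (iv) $\alpha$ restricts to a topological automorphism $\alpha_G$ of $G$, and if $\eta_1,\eta_2$ are independent identically distributed random variables with values in $G$ and distribution $\lambda$, then the conditional distribution of $M_2=\eta_1+\alpha_G\eta_2$ given $M_1=\eta_1+\eta_2$ is symmetric. -/

import Mathlib

open MeasureTheory ProbabilityTheory

noncomputable section

/-- `A` is, up to topological isomorphism, either a finite cyclic `p`-group `ℤ(p^k)` (discrete)
or the additive group of `p`-adic integers. -/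
def IsCyclicOrPadic (p : ℕ) [Fact p.Prime] (A : Type*) [AddCommGroup A] [TopologicalSpace A] :
    Prop :=
  (∃ k : ℕ, Nonempty (A ≃ₜ+ ZMod (p ^ k))) ∨ Nonempty (A ≃ₜ+ ℤ_[p])

/-- The conditional distribution of `η` given `ξ` is symmetric: the random vectors `(ξ, η)` and
`(ξ, -η)` are identically distributed. -/
def CondSymmetric {Ω X : Type*} [MeasurableSpace Ω] [MeasurableSpace X] [Neg X]
    (P : Measure Ω) (η ξ : Ω → X) : Prop :=
  IdentDistrib (fun ω => (ξ ω, η ω)) (fun ω => (ξ ω, -η ω)) P P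

section Distributions

variable {X : Type*} [AddCommGroup X] [MeasurableSpace X]

/-- `μ` is a shift of `lam`: the convolution of `lam` with a degenerate distribution. -/
def IsShift (μ lam : Measure X) : Prop :=
  ∃ x : X, μ = lam.conv (Measure.dirac x)

/-- `μ₁` is a factor of `μ`: `μ = μ₁ * μ₂` for some probability distribution `μ₂`. -/
def IsFactor (μ₁ μ : Measure X) : Prop :=
  ∃ μ₂ : Measure X, IsProbabilityMeasure μ₂ ∧ μ = μ₁.conv μ₂

/-- The Haar distribution `m_K` of a compact subgroup `K` of `X`, as a distribution on `X`:
the Haar measure of the group `K`, normalized by `m_K(K) = 1`, pushed forward to `X`. -/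
def haarDistribution [TopologicalSpace X] [IsTopologicalAddGroup X] [BorelSpace X]
    (K : AddSubgroup X) (hK : IsCompact (K : Set X)) : Measure X :=
  haveI : CompactSpace K := isCompact_iff_compactSpace.mp hK
  (Measure.addHaarMeasure (⊤ : TopologicalSpace.PositiveCompacts K)).map (Subtype.val : K → X)

end Distributions

end

/-- The properties of the characteristic function of a probability distribution, as a function on
the character group, that are used below. -/
structure IsCharLike {Y : Type*} [AddCommGroup Y] (f : Y → ℂ) : Prop where
  map_zero : f 0 = 1
  norm_le_one : ∀ y, ‖f y‖ ≤ 1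
  norm_neg : ∀ y, ‖f (-y)‖ = ‖f y‖
  map_add : ∀ y e, ‖f e‖ = 1 → f (y + e) = f y * f e

/-- Heyde's functional equation. -/
def HeydeEq {Y : Type*} [AddCommGroup Y] (α : Y → Y) (f g : Y → ℂ) : Prop :=
  ∀ u v, f (u + v) * g (u + α v) = f (u - v) * g (u - α v)

/-- The subgroup on which a function of modulus at most one has modulus one. -/
def IsCharLike.unitSubgroup {Y : Type*} [AddCommGroup Y] {f : Y → ℂ} (hf : IsCharLike f) :
    AddSubgroup Y where
  carrier := {y | ‖f y‖ = 1}
  zero_mem' := by simp [hf.map_zero]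
  add_mem' := by
    intro a b ha hb
    simp only [Set.mem_ofPred_eq] at ha hb ⊢
    rw [hf.map_add a b hb, norm_mul, ha, hb, one_mul]
  neg_mem' := by
    intro a ha
    simp only [Set.mem_ofPred_eq] at ha ⊢
    rw [hf.norm_neg, ha]

lemma IsCharLike.mem_unitSubgroup {Y : Type*} [AddCommGroup Y] {f : Y → ℂ} (hf : IsCharLike f)
    {y : Y} : y ∈ hf.unitSubgroup ↔ ‖f y‖ = 1 := Iff.rfl

lemma IsCharLike.norm_add_of_mem {Y : Type*} [AddCommGroup Y] {f : Y → ℂ} (hf : IsCharLike f)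
    {y e : Y} (he : e ∈ hf.unitSubgroup) : ‖f (y + e)‖ = ‖f y‖ := by
  have he' : ‖f e‖ = 1 := he
  rw [hf.map_add y e he, norm_mul, he', mul_one]

lemma eq_of_comp_le_comp_of_bijective {C : Type*} [Finite C] {F G : C → ℝ} {r s t : C → C}
    (hr : r.Bijective) (hs : s.Bijective) (ht : t.Bijective)
    (h₁ : ∀ c, G (r c) ≤ F (s c)) (h₂ : ∀ c, F (r c) ≤ G (t c)) (c : C) :
    G (r c) = F (s c) ∧ F (r c) = G (t c) := by
  have := Fintype.ofFinite C
  have key : ∀ (H : C → ℝ) {q : C → C}, q.Bijective → ∑ c, H (q c) = ∑ c, H c :=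
    fun H q hq => hq.sum_comp H
  have l₁ : ∑ c, G (r c) ≤ ∑ c, F (s c) := Finset.sum_le_sum fun c _ => h₁ c
  have l₂ : ∑ c, F (r c) ≤ ∑ c, G (t c) := Finset.sum_le_sum fun c _ => h₂ c
  have e₁ : ∑ c, G (r c) = ∑ c, F (s c) := by
    refine le_antisymm l₁ ?_
    rw [key F hs, key G hr, ← key F hr, ← key G ht]; exact l₂
  have e₂ : ∑ c, F (r c) = ∑ c, G (t c) := by
    refine le_antisymm l₂ ?_
    rw [key F hr, key G ht, ← key F hs, ← key G hr]; exact l₁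
  exact ⟨(Finset.sum_eq_sum_iff_of_le fun c _ => h₁ c).1 e₁ c (Finset.mem_univ c),
    (Finset.sum_eq_sum_iff_of_le fun c _ => h₂ c).1 e₂ c (Finset.mem_univ c)⟩

section Heyde

variable {Y : Type*} [AddCommGroup Y]

lemma exists_two_nsmul_mem_zmultiples {y : Y} (hy : ∃ n : ℕ, Odd n ∧ n • y = 0) :
    ∃ w ∈ AddSubgroup.zmultiples y, 2 • w = y := by
  obtain ⟨n, ⟨k, rfl⟩, hn⟩ := hy
  refine ⟨(k + 1) • y, AddSubgroup.nsmul_mem_zmultiples y _, ?_⟩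
  rw [smul_smul, show 2 * (k + 1) = (2 * k + 1) + 1 by ring, add_smul, hn, zero_add, one_smul]

lemma mem_of_two_nsmul_mem {y : Y} (hy : ∃ n : ℕ, Odd n ∧ n • y = 0) {E : AddSubgroup Y}
    (h : 2 • y ∈ E) : y ∈ E := by
  obtain ⟨n, ⟨k, rfl⟩, hn⟩ := hy
  have := E.nsmul_mem h (k + 1)
  rwa [smul_smul, show (k + 1) * 2 = (2 * k + 1) + 1 by ring, add_smul, hn, zero_add,
    one_smul] at this

variable {α : Y ≃+ Y} {f g : Y → ℂ}

lemma HeydeEq.diagonal (hf : IsCharLike f) (h : HeydeEq α f g) (v : Y) :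
    f (2 • v) * g (v + α v) = g (v - α v) := by
  have := h v v
  rwa [sub_self, hf.map_zero, one_mul, ← two_nsmul] at this

lemma HeydeEq.twisted_diagonal (hg : IsCharLike g) (h : HeydeEq α f g) (v : Y) :
    f (v + α v) * g (2 • α v) = f (-(v - α v)) := by
  have := h (α v) v
  rwa [sub_self, hg.map_zero, mul_one, ← two_nsmul, add_comm (α v), ← neg_sub v] at this

lemma HeydeEq.norm_sub_le_left (hf : IsCharLike f) (hg : IsCharLike g) (h : HeydeEq α f g)
    (v : Y) : ‖g (v - α v)‖ ≤ ‖f (2 • v)‖ := by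
  rw [← h.diagonal hf, norm_mul]
  exact mul_le_of_le_one_right (norm_nonneg _) (hg.norm_le_one _)

lemma HeydeEq.norm_sub_le_right (hf : IsCharLike f) (hg : IsCharLike g) (h : HeydeEq α f g)
    (v : Y) : ‖f (v - α v)‖ ≤ ‖g (2 • α v)‖ := by
  rw [← hf.norm_neg, ← h.twisted_diagonal hg, norm_mul]
  exact mul_le_of_le_one_left (norm_nonneg _) (hf.norm_le_one _)

lemma HeydeEq.norm_sub_le_left' (hf : IsCharLike f) (h : HeydeEq α f g)
    (v : Y) : ‖g (v - α v)‖ ≤ ‖g (v + α v)‖ := by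
  rw [← h.diagonal hf, norm_mul]
  exact mul_le_of_le_one_left (norm_nonneg _) (hf.norm_le_one _)

lemma HeydeEq.norm_sub_le_right' (hf : IsCharLike f) (hg : IsCharLike g) (h : HeydeEq α f g)
    (v : Y) : ‖f (v - α v)‖ ≤ ‖f (v + α v)‖ := by
  rw [← hf.norm_neg, ← h.twisted_diagonal hg, norm_mul]
  exact mul_le_of_le_one_right (norm_nonneg _) (hg.norm_le_one _)

variable (htors : ∀ y : Y, ∃ n : ℕ, Odd n ∧ n • y = 0)
  (hα : ∀ y, ∃ a : ℤ, α y = a • y) (hα' : ∀ y, ∃ a : ℤ, α.symm y = a • y)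

include hα in
lemma apply_mem_of_mem {E : AddSubgroup Y} {y : Y} (hy : y ∈ E) : α y ∈ E := by
  obtain ⟨a, ha⟩ := hα y
  exact ha ▸ E.zsmul_mem hy a

include hα' in
lemma mem_of_apply_mem {E : AddSubgroup Y} {y : Y} (hy : α y ∈ E) : y ∈ E := by
  have := apply_mem_of_mem (α := α.symm) hα' hy
  rwa [AddEquiv.symm_apply_apply] at this

include htors in
lemma HeydeEq.mem_of_sub_mem_right (hf : IsCharLike f) (hg : IsCharLike g) (h : HeydeEq α f g)
    {v : Y} (hv : v - α v ∈ hg.unitSubgroup) : v ∈ hf.unitSubgroup ∧ v ∈ hg.unitSubgroup := by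
  have hv' : ‖g (v - α v)‖ = 1 := hv
  constructor
  · refine mem_of_two_nsmul_mem (htors v) (le_antisymm (hf.norm_le_one _) ?_)
    exact hv' ▸ h.norm_sub_le_left hf hg v
  · refine mem_of_two_nsmul_mem (htors v) ?_
    have : v + α v ∈ hg.unitSubgroup :=
      le_antisymm (hg.norm_le_one _) (hv' ▸ h.norm_sub_le_left' hf v)
    convert add_mem hv this using 1
    rw [two_nsmul]; abel

include htors hα' in
lemma HeydeEq.mem_of_sub_mem_left (hf : IsCharLike f) (hg : IsCharLike g) (h : HeydeEq α f g)
    {v : Y} (hv : v - α v ∈ hf.unitSubgroup) : v ∈ hf.unitSubgroup ∧ v ∈ hg.unitSubgroup := by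
  have hv' : ‖f (v - α v)‖ = 1 := hv
  constructor
  · refine mem_of_two_nsmul_mem (htors v) ?_
    have : v + α v ∈ hf.unitSubgroup :=
      le_antisymm (hf.norm_le_one _) (hv' ▸ h.norm_sub_le_right' hf hg v)
    convert add_mem hv this using 1
    rw [two_nsmul]; abel
  · refine mem_of_apply_mem hα' (mem_of_two_nsmul_mem (htors _)
      (le_antisymm (hg.norm_le_one _) ?_))
    exact hv' ▸ h.norm_sub_le_right hf hg v

include htors hα hα' in
lemma HeydeEq.unitSubgroup_eq (hf : IsCharLike f) (hg : IsCharLike g) (h : HeydeEq α f g) :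
    hf.unitSubgroup = hg.unitSubgroup := by
  refine le_antisymm (fun v hv => ?_) (fun v hv => ?_)
  · exact (h.mem_of_sub_mem_left htors hα' hf hg (sub_mem hv (apply_mem_of_mem hα hv))).2
  · exact (h.mem_of_sub_mem_right htors hf hg (sub_mem hv (apply_mem_of_mem hα hv))).1

include htors hα hα' in
lemma HeydeEq.norm_sub_eq (hf : IsCharLike f) (hg : IsCharLike g) (h : HeydeEq α f g) (v : Y) :
    ‖g (v - α v)‖ = ‖f (2 • v)‖ ∧ ‖f (v - α v)‖ = ‖g (2 • α v)‖ := by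
  have hE := h.unitSubgroup_eq htors hα hα' hf hg
  set E := hf.unitSubgroup
  obtain ⟨a, ha⟩ := hα v
  have hak : ∀ k : ℤ, α (k • v) = a • k • v := fun k => by
    rw [map_zsmul, ha, smul_comm]
  let F : Y ⧸ E → ℝ := fun q => Quotient.liftOn' q (fun y => ‖f y‖) (by
    intro x y hxy
    rw [QuotientAddGroup.leftRel_apply] at hxy
    have := hf.norm_add_of_mem (y := x) hxy
    rwa [add_neg_cancel_left, eq_comm] at this)
  let G : Y ⧸ E → ℝ := fun q => Quotient.liftOn' q (fun y => ‖g y‖) (by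
    intro x y hxy
    rw [QuotientAddGroup.leftRel_apply, hE] at hxy
    have := hg.norm_add_of_mem (y := x) hxy
    rwa [add_neg_cancel_left, eq_comm] at this)
  let C : AddSubgroup (Y ⧸ E) := AddSubgroup.zmultiples (v : Y ⧸ E)
  have hfin : Finite C := by
    obtain ⟨n, hn, hnv⟩ := htors v
    refine (isOfFinAddOrder_iff_nsmul_eq_zero.2 ⟨n, hn.pos, ?_⟩ :
      IsOfFinAddOrder (v : Y ⧸ E)).finite_zmultiples
    rw [← QuotientAddGroup.mk_nsmul, hnv, QuotientAddGroup.mk_zero]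
  have hC : ∀ c : C, ∃ k : ℤ, (c : Y ⧸ E) = ((k • v : Y) : Y ⧸ E) := by
    rintro ⟨c, k, rfl⟩
    exact ⟨k, by simp⟩
  have hbij : ∀ m : ℤ, (∀ k : ℤ, m • k • v ∈ E → k • v ∈ E) →
      Function.Bijective (fun c : C => m • c) := by
    intro m hm
    refine Finite.injective_iff_bijective.1 ?_
    refine (injective_iff_map_eq_zero (zsmulAddGroupHom m : C →+ C)).2 fun c hc => ?_
    obtain ⟨k, hk⟩ := hC c
    have hc' : m • (c : Y ⧸ E) = 0 := congrArg Subtype.val hc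
    rw [hk, ← QuotientAddGroup.mk_zsmul, QuotientAddGroup.eq_zero_iff] at hc'
    exact Subtype.ext (hk.trans ((QuotientAddGroup.eq_zero_iff _).2 (hm k hc')))
  have b₁ := hbij (1 - a) fun k hk => by
    refine (h.mem_of_sub_mem_left htors hα' hf hg ?_).1
    rwa [hak, ← one_smul ℤ (k • v), smul_smul a, mul_one, ← sub_smul]
  have b₂ := hbij 2 fun k hk => mem_of_two_nsmul_mem (htors _) (by exact_mod_cast hk)
  have ba := hbij a fun k hk => mem_of_apply_mem hα' (by rwa [hak])
  have key := eq_of_comp_le_comp_of_bijective (F := fun c : C => F c) (G := fun c : C => G c)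
    b₁ b₂ (b₂.comp ba) ?_ ?_ ⟨v, AddSubgroup.mem_zmultiples _⟩
  · have e1 : (1 - a) • v = v - α v := by rw [sub_smul, one_smul, ha]
    have e2 : (2 : ℤ) • v = 2 • v := by norm_cast
    have e3 : (2 : ℤ) • a • v = 2 • α v := by rw [ha]; norm_cast
    rw [← e1, ← e2, ← e3]
    exact key
  · intro c
    obtain ⟨k, hk⟩ := hC c
    have := h.norm_sub_le_left hf hg (k • v)
    rw [hak, ← one_smul ℤ (k • v), smul_smul a, mul_one, ← sub_smul, one_smul,
      ← natCast_zsmul] at this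
    change G ((1 - a) • (c : Y ⧸ E)) ≤ F ((2 : ℤ) • (c : Y ⧸ E))
    rw [hk]
    exact this
  · intro c
    obtain ⟨k, hk⟩ := hC c
    have := h.norm_sub_le_right hf hg (k • v)
    rw [hak, ← one_smul ℤ (k • v), smul_smul a, mul_one, ← sub_smul,
      ← natCast_zsmul] at this
    change F ((1 - a) • (c : Y ⧸ E)) ≤ G ((2 : ℤ) • a • (c : Y ⧸ E))
    rw [hk]
    exact this

include htors hα hα' in
lemma HeydeEq.add_mem_of_left_ne_zero (hf : IsCharLike f) (hg : IsCharLike g)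
    (h : HeydeEq α f g) {w : Y} (hw : f w ≠ 0) : w + α w ∈ hf.unitSubgroup := by
  obtain ⟨v, -, rfl⟩ := exists_two_nsmul_mem_zmultiples (htors w)
  have h₁ := congrArg norm (h.diagonal hf v)
  rw [norm_mul, (h.norm_sub_eq htors hα hα' hf hg v).1] at h₁
  have h₂ : v + α v ∈ hg.unitSubgroup := by
    refine mul_left_cancel₀ (norm_ne_zero_iff.2 hw) ?_
    rw [h₁, mul_one]
  rw [← h.unitSubgroup_eq htors hα hα' hf hg] at h₂
  have := AddSubgroup.nsmul_mem _ h₂ 2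
  rwa [smul_add, ← map_nsmul] at this

include htors hα hα' in
lemma HeydeEq.add_mem_of_right_ne_zero (hf : IsCharLike f) (hg : IsCharLike g)
    (h : HeydeEq α f g) {w : Y} (hw : g w ≠ 0) : w + α w ∈ hf.unitSubgroup := by
  obtain ⟨w, rfl⟩ := α.surjective w
  obtain ⟨v, -, rfl⟩ := exists_two_nsmul_mem_zmultiples (htors w)
  rw [map_nsmul] at hw
  have h₁ := congrArg norm (h.twisted_diagonal hg v)
  rw [norm_mul, hf.norm_neg, (h.norm_sub_eq htors hα hα' hf hg v).2] at h₁
  have h₂ : v + α v ∈ hf.unitSubgroup := by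
    refine mul_right_cancel₀ (norm_ne_zero_iff.2 hw) ?_
    rw [h₁, one_mul]
  have := apply_mem_of_mem hα (AddSubgroup.nsmul_mem _ h₂ 2)
  rwa [smul_add, map_add, map_nsmul, map_nsmul, ← map_nsmul α 2 (α v), ← map_nsmul α 2 v] at this

include htors hα hα' in
lemma HeydeEq.eq_one_of_mem (hf : IsCharLike f) (hg : IsCharLike g)
    (h : HeydeEq α f g) (h1 : ∀ y ∈ hf.unitSubgroup, f y = 1) {y : Y}
    (hy : y ∈ hf.unitSubgroup) : g y = 1 := by
  obtain ⟨v, hv, rfl⟩ := exists_two_nsmul_mem_zmultiples (htors y)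
  replace hv : v ∈ hf.unitSubgroup := (AddSubgroup.zmultiples_le_of_mem hy) hv
  replace hv : α.symm v ∈ hf.unitSubgroup := apply_mem_of_mem (α := α.symm) hα' hv
  obtain ⟨v, rfl⟩ := α.surjective v
  rw [AddEquiv.symm_apply_apply] at hv
  have hE := h.unitSubgroup_eq htors hα hα' hf hg
  have e := h.diagonal hf v
  rw [h1 _ (AddSubgroup.nsmul_mem _ hv 2), one_mul] at e
  have hm : ‖g (2 • α v)‖ = 1 := by
    rw [← hg.mem_unitSubgroup, ← hE]; exact hy
  have hm' : v - α v ∈ hg.unitSubgroup := by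
    rw [← hE]; exact sub_mem hv (apply_mem_of_mem hα hv)
  rw [show v + α v = v - α v + 2 • α v by rw [two_nsmul]; abel, hg.map_add _ _ hm] at e
  have h0 : g (v - α v) ≠ 0 := by
    rw [← norm_ne_zero_iff, hg.mem_unitSubgroup.1 hm']; exact one_ne_zero
  exact mul_left_cancel₀ h0 (e.trans (mul_one _).symm)

include htors hα hα' in
lemma HeydeEq.eq_of_eq_one (hf : IsCharLike f) (hg : IsCharLike g)
    (h : HeydeEq α f g) (h1 : ∀ y ∈ hf.unitSubgroup, f y = 1) : f = g := by
  have hE := h.unitSubgroup_eq htors hα hα' hf hg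
  funext y
  have key : y + α y ∈ hf.unitSubgroup → f y = g y := by
    intro hy
    obtain ⟨v, hv, rfl⟩ := exists_two_nsmul_mem_zmultiples (htors y)
    have hm : v + α v ∈ hf.unitSubgroup := by
      refine mem_of_two_nsmul_mem (htors _) ?_
      rwa [smul_add, ← map_nsmul]
    have e := h.diagonal hf v
    have hm' : ‖g (v + α v)‖ = 1 := by rw [← hg.mem_unitSubgroup, ← hE]; exact hm
    have hg1 := h.eq_one_of_mem htors hα hα' hf hg h1 hm
    rw [show 2 • v = v - α v + (v + α v) by rw [two_nsmul]; abel, hg.map_add _ _ hm', ← e,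
      hg1, mul_one, mul_one]
    congr 1
    rw [two_nsmul]; abel
  by_cases h0 : f y = 0
  · by_cases h0' : g y = 0
    · rw [h0, h0']
    · exact key (h.add_mem_of_right_ne_zero htors hα hα' hf hg h0')
  · exact key (h.add_mem_of_left_ne_zero htors hα hα' hf hg h0)

end Heyde

section Characters

variable {X : Type*} [AddCommGroup X] [TopologicalSpace X]

variable (X) in
/-- The group of continuous characters of a topological abelian group. -/
noncomputable def contAddChar : AddSubgroup (AddChar X Circle) where
  carrier := {y | Continuous y}
  zero_mem' := by
    change Continuous fun _ : X => (1 : Circle)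
    exact continuous_const
  add_mem' := by
    intro a b ha hb
    change Continuous fun x => a x * b x
    exact Continuous.mul ha hb
  neg_mem' := by
    intro a ha
    change Continuous fun x => a (-x)
    simp only [AddChar.map_neg_eq_inv]
    exact Continuous.inv ha

lemma contAddChar.continuous (y : contAddChar X) : Continuous y.1 := y.2

lemma contAddChar.continuous_coe (y : contAddChar X) : Continuous fun x => (y.1 x : ℂ) :=
  continuous_subtype_val.comp (contAddChar.continuous y)

/-- The homomorphism of character groups that is dual to a continuous homomorphism. -/
noncomputable def contAddChar.comap {X' : Type*} [AddCommGroup X'] [TopologicalSpace X'] (φ : X →+ X')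
    (hφ : Continuous φ) : contAddChar X' →+ contAddChar X where
  toFun y := ⟨y.1.compAddMonoidHom φ, (contAddChar.continuous y).comp hφ⟩
  map_zero' := rfl
  map_add' _ _ := rfl

/-- The automorphism of the character group that is dual to a topological automorphism. -/
noncomputable def contAddChar.congr (α : X ≃ₜ+ X) : contAddChar X ≃+ contAddChar X where
  toFun := contAddChar.comap (α : X →+ X) α.continuous
  invFun := contAddChar.comap (α.symm : X →+ X) α.symm.continuous
  left_inv y := by
    ext x
    change ((y.1 (α (α.symm x)) : Circle) : ℂ) = y.1 x
    rw [ContinuousAddEquiv.apply_symm_apply]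
  right_inv y := by
    ext x
    change ((y.1 (α.symm (α x)) : Circle) : ℂ) = y.1 x
    rw [ContinuousAddEquiv.symm_apply_apply]
  map_add' _ _ := rfl

/-- The closed subgroup of points annihilated by a set of characters. -/
noncomputable def contAddChar.annihilator (E : AddSubgroup (contAddChar X)) : AddSubgroup X where
  carrier := {x | ∀ y ∈ E, y.1 x = 1}
  zero_mem' := by intro y _; exact y.1.map_zero_eq_one
  add_mem' := by
    intro a b ha hb y hy
    rw [AddChar.map_add_eq_mul, ha y hy, hb y hy, one_mul]
  neg_mem' := by
    intro a ha y hy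
    rw [AddChar.map_neg_eq_inv, ha y hy, inv_one]

lemma contAddChar.isClosed_annihilator (E : AddSubgroup (contAddChar X)) :
    IsClosed (contAddChar.annihilator E : Set X) := by
  have : (contAddChar.annihilator E : Set X) = ⋂ y ∈ E, {x | y.1 x = 1} := by
    ext x; simp only [Set.mem_iInter]; rfl
  rw [this]
  exact isClosed_biInter fun y _ => isClosed_eq (contAddChar.continuous y) continuous_const

variable [IsTopologicalAddGroup X] [CompactSpace X]

/-- A profinite abelian group has a basis of neighbourhoods of zero of open subgroups. -/
lemma exists_openAddSubgroup_subset [T2Space X] [TotallyDisconnectedSpace X] {U : Set X}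
    (hU : U ∈ nhds (0 : X)) : ∃ N : OpenAddSubgroup X, (N : Set X) ⊆ U := by
  obtain ⟨V, hV, h0, hVU⟩ := compact_exists_isClopen_in_isOpen isOpen_interior
    (mem_interior_iff_mem_nhds.2 hU)
  obtain ⟨N, hN⟩ := IsTopologicalAddGroup.exist_openAddSubgroup_sub_clopen_nhds_of_zero hV h0
  exact ⟨N, hN.trans (hVU.trans interior_subset)⟩

lemma finite_quotient_of_isOpen {N : AddSubgroup X} (hN : IsOpen (N : Set X)) :
    Finite (X ⧸ N) :=
  N.quotient_finite_of_isOpen hN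

/-- Continuous characters of a profinite abelian group separate points from closed subgroups. -/
lemma exists_contAddChar_ne_one [T2Space X] [TotallyDisconnectedSpace X] {H : AddSubgroup X}
    (hH : IsClosed (H : Set X)) {x : X} (hx : x ∉ H) :
    ∃ y : contAddChar X, (∀ h ∈ H, y.1 h = 1) ∧ y.1 x ≠ 1 := by
  have hU : (fun z => x - z) ⁻¹' (H : Set X)ᶜ ∈ nhds (0 : X) := by
    refine (hH.isOpen_compl.preimage (by fun_prop)).mem_nhds ?_
    simpa using hx
  obtain ⟨N, hN⟩ := exists_openAddSubgroup_subset hU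
  set M : AddSubgroup X := H ⊔ N.toAddSubgroup
  have hM : IsOpen (M : Set X) := AddSubgroup.isOpen_mono le_sup_right N.isOpen
  have hxM : x ∉ M := by
    intro hxM
    obtain ⟨h, hh, n, hn, rfl⟩ := AddSubgroup.mem_sup.1 hxM
    exact hN hn (by simpa using hh)
  have := finite_quotient_of_isOpen hM
  have := QuotientAddGroup.discreteTopology hM
  have hx0 : (x : X ⧸ M) ≠ 0 := fun h => hxM ((QuotientAddGroup.eq_zero_iff x).1 h)
  obtain ⟨ψ, hψ⟩ := AddChar.exists_apply_ne_zero.2 hx0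
  let ψ' : AddChar (X ⧸ M) Circle := AddChar.circleEquivComplex.symm ψ
  have hψ' : ∀ q, ((ψ' q : Circle) : ℂ) = ψ q := fun q => rfl
  refine ⟨⟨ψ'.compAddMonoidHom (QuotientAddGroup.mk' M),
    (continuous_of_discreteTopology (f := ψ')).comp continuous_quotient_mk'⟩, ?_, ?_⟩
  · intro h hh
    have : (h : X ⧸ M) = 0 := (QuotientAddGroup.eq_zero_iff h).2 (le_sup_left (a := H) hh)
    change ψ' (h : X ⧸ M) = 1
    rw [this, AddChar.map_zero_eq_one]
  · change ψ' (x : X ⧸ M) ≠ 1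
    intro h
    apply hψ
    rw [← hψ', h, Circle.coe_one]

lemma exists_contAddChar_ne [T2Space X] [TotallyDisconnectedSpace X] {x x' : X} (h : x ≠ x') :
    ∃ y : contAddChar X, y.1 x ≠ y.1 x' := by
  obtain ⟨y, -, hy⟩ := exists_contAddChar_ne_one (H := (⊥ : AddSubgroup X)) (x := x - x')
    (by simp) (by simpa [sub_eq_zero] using h)
  refine ⟨y, fun h' => hy ?_⟩
  rw [AddChar.map_sub_eq_div, h', div_self']

/-- A subgroup of the circle inside the right half-plane is trivial. -/
lemma Circle.eq_one_of_forall_pow_re_pos {z : Circle} (h : ∀ n : ℕ, 0 < ((z ^ n : Circle) : ℂ).re) :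
    z = 1 := by
  by_contra hz
  have hre : ∀ w : Circle, ((w ^ 2 : Circle) : ℂ).re = 2 * (w : ℂ).re ^ 2 - 1 := by
    intro w
    have := Circle.normSq_coe w
    rw [Complex.normSq_apply] at this
    rw [Circle.coe_pow, pow_two, Complex.mul_re]
    linarith
  have h1 : (z : ℂ).re < 1 := by
    refine lt_of_le_of_ne ?_ fun h1 => hz ?_
    · exact (Complex.re_le_norm (z : ℂ)).trans_eq (Circle.norm_coe z)
    · have := Circle.normSq_coe z
      rw [Complex.normSq_apply, h1] at this
      have him : (z : ℂ).im = 0 := by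
        have : (z : ℂ).im * (z : ℂ).im = 0 := by linarith
        simpa using this
      ext
      exact Complex.ext (by simpa using h1) (by simpa using him)
  have key : ∀ n : ℕ, ((z ^ 2 ^ n : Circle) : ℂ).re ≤ 1 - 2 ^ n * (1 - (z : ℂ).re) := by
    intro n
    induction n with
    | zero => simp
    | succ n ih =>
      have hp := h (2 ^ n)
      have h1' : ((z ^ 2 ^ n : Circle) : ℂ).re ≤ 1 :=
        (Complex.re_le_norm _).trans_eq (Circle.norm_coe _)
      have e : z ^ 2 ^ (n + 1) = (z ^ 2 ^ n) ^ 2 := by rw [pow_succ 2 n, pow_mul]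
      have hsq : ((z ^ 2 ^ n : Circle) : ℂ).re ^ 2 ≤ ((z ^ 2 ^ n : Circle) : ℂ).re :=
        pow_le_of_le_one hp.le h1' two_ne_zero
      rw [e, hre, pow_succ (2 : ℝ)]
      linarith
  obtain ⟨n, hn⟩ := pow_unbounded_of_one_lt (1 / (1 - (z : ℂ).re)) one_lt_two
  rw [div_lt_iff₀ (by linarith)] at hn
  linarith [key n, h (2 ^ n)]

lemma contAddChar.exists_nsmul_eq_zero [T2Space X] [TotallyDisconnectedSpace X]
    (y : contAddChar X) : ∃ n : ℕ, 0 < n ∧ n • y = 0 := by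
  have hU : {x : X | 0 < (y.1 x : ℂ).re} ∈ nhds (0 : X) := by
    refine (isOpen_lt continuous_const
      (Complex.continuous_re.comp (contAddChar.continuous_coe y))).mem_nhds ?_
    simp
  obtain ⟨N, hN⟩ := exists_openAddSubgroup_subset hU
  have hker : ∀ x ∈ N, y.1 x = 1 := fun x hx => by
    refine Circle.eq_one_of_forall_pow_re_pos fun n => ?_
    rw [← AddChar.map_nsmul_eq_pow]
    exact hN (N.toAddSubgroup.nsmul_mem hx n)
  have := finite_quotient_of_isOpen N.isOpen
  refine ⟨Nat.card (X ⧸ N.toAddSubgroup), Nat.card_pos, ?_⟩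
  ext x
  change (((Nat.card (X ⧸ N.toAddSubgroup) • y.1) x : Circle) : ℂ) = 1
  rw [AddChar.nsmul_apply, ← AddChar.map_nsmul_eq_pow, hker, Circle.coe_one]
  refine (QuotientAddGroup.eq_zero_iff _).1 ?_
  rw [QuotientAddGroup.mk_nsmul]
  exact card_nsmul_eq_zero'

lemma contAddChar.exists_odd_nsmul_eq_zero [T2Space X] [TotallyDisconnectedSpace X]
    (h2 : ∀ x : X, ∃ x', 2 • x' = x) (y : contAddChar X) : ∃ n : ℕ, Odd n ∧ n • y = 0 := by
  obtain ⟨n, hn, hy⟩ := contAddChar.exists_nsmul_eq_zero y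
  obtain ⟨k, m, hm, rfl⟩ := Nat.exists_eq_two_pow_mul_odd hn.ne'
  refine ⟨m, hm, ?_⟩
  have htwo : ∀ z : contAddChar X, 2 • z = 0 → z = 0 := by
    intro z hz
    ext x
    obtain ⟨x, rfl⟩ := h2 x
    rw [AddChar.map_nsmul_eq_pow, ← AddChar.nsmul_apply]
    exact congrArg (fun w : contAddChar X => ((w.1 x : Circle) : ℂ)) hz
  induction k with
  | zero => simpa using hy
  | succ k ih =>
    refine ih (Nat.mul_pos (by positivity) hm.pos) (htwo _ ?_)
    rw [smul_smul, ← hy]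
    ring_nf

/-- On a monothetic profinite group, every topological endomorphism acts on each character as
multiplication by an integer. -/
lemma contAddChar.exists_congr_eq_zsmul [T2Space X] [TotallyDisconnectedSpace X] {x₀ : X}
    (hx₀ : Dense (AddSubgroup.zmultiples x₀ : Set X)) (α : X ≃ₜ+ X) (y : contAddChar X) :
    ∃ a : ℤ, contAddChar.congr α y = a • y := by
  obtain ⟨n, hn, hy⟩ := contAddChar.exists_nsmul_eq_zero y
  have hker : IsOpen {x : X | y.1 x = y.1 (α x₀)} := by
    have hcl : ∀ x, (y.1 x) ^ n = 1 := fun x => by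
      rw [← AddChar.nsmul_apply]
      exact congrArg (fun w : contAddChar X => w.1 x) hy
    have hfin : (Set.range y.1).Finite := by
      refine Set.Finite.subset (s := {z : Circle | z ^ n = 1}) ?_ ?_
      · refine Set.Finite.of_finite_image (f := fun z : Circle => (z : ℂ)) ?_
          (Circle.coe_injective.injOn)
        refine (Polynomial.nthRootsFinset n (1 : ℂ)).finite_toSet.subset ?_
        rintro _ ⟨z, hz, rfl⟩
        rw [Finset.mem_coe, Polynomial.mem_nthRootsFinset hn]
        have hz' : z ^ n = 1 := hz
        rw [← Circle.coe_pow, hz', Circle.coe_one]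
      · rintro _ ⟨x, rfl⟩
        exact hcl x
    have : {x : X | y.1 x = y.1 (α x₀)} =
        (y.1 ⁻¹' (Set.range y.1 \ {y.1 (α x₀)}))ᶜ := by
      ext x; simp
    rw [this]
    exact ((hfin.subset Set.sdiff_subset).isClosed.preimage (contAddChar.continuous y)).isOpen_compl
  obtain ⟨_, hx, a, rfl⟩ := hx₀.inter_open_nonempty _ hker ⟨α x₀, rfl⟩
  refine ⟨a, Subtype.ext (DFunLike.coe_injective ?_)⟩
  refine Continuous.ext_on hx₀ (contAddChar.continuous _) (contAddChar.continuous _) ?_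
  rintro _ ⟨k, rfl⟩
  change y.1 (α (k • x₀)) = (a • y.1) (k • x₀)
  have hx' : y.1 (a • x₀) = y.1 (α x₀) := hx
  rw [map_zsmul, AddChar.map_zsmul_eq_zpow, ← hx', AddChar.zsmul_apply,
    AddChar.map_zsmul_eq_zpow, AddChar.map_zsmul_eq_zpow, zpow_comm]

end Characters

section CharFn

/-- Characters, as a multiplicative family of bounded continuous functions. -/
noncomputable def contAddChar.toBCF {X : Type*} [AddCommGroup X] [TopologicalSpace X]
    [CompactSpace X] :
    Multiplicative (contAddChar X) →* BoundedContinuousFunction X ℂ where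
  toFun y := BoundedContinuousFunction.mkOfCompact
    ⟨fun x => (y.toAdd.1 x : ℂ), contAddChar.continuous_coe y.toAdd⟩
  map_one' := by ext x; exact Circle.coe_one
  map_mul' a b := by ext x; exact Circle.coe_mul _ _

variable {X : Type*} [AddCommGroup X] [TopologicalSpace X] [MeasurableSpace X]

/-- The characteristic function of a distribution on a topological abelian group. -/
noncomputable def charFn (μ : Measure X) (y : contAddChar X) : ℂ := ∫ x, (y.1 x : ℂ) ∂μ

lemma charFn_zero (μ : Measure X) [IsProbabilityMeasure μ] : charFn μ 0 = 1 := by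
  change ∫ _ : X, (((1 : Circle) : ℂ)) ∂μ = 1
  simp

lemma norm_charFn_le_one (μ : Measure X) [IsProbabilityMeasure μ] (y : contAddChar X) :
    ‖charFn μ y‖ ≤ 1 := by
  refine (norm_integral_le_of_norm_le_const (C := 1)
    (Filter.Eventually.of_forall fun x => (Circle.norm_coe (y.1 x)).le)).trans_eq ?_
  simp

lemma charFn_neg (μ : Measure X) (y : contAddChar X) :
    charFn μ (-y) = starRingEnd ℂ (charFn μ y) := by
  unfold charFn
  rw [← integral_conj]
  refine integral_congr_ae (Filter.Eventually.of_forall fun x => ?_)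
  change ((y.1 (-x) : Circle) : ℂ) = _
  rw [AddChar.map_neg_eq_inv, Circle.coe_inv_eq_conj]

lemma charFn_eq_of_ae {μ : Measure X} [IsProbabilityMeasure μ] {y : contAddChar X} {c : ℂ}
    (h : ∀ᵐ x ∂μ, (y.1 x : ℂ) = c) : charFn μ y = c := by
  unfold charFn
  rw [integral_congr_ae h]; simp

variable [BorelSpace X]

lemma contAddChar.integrable (y : contAddChar X) (μ : Measure X) [IsFiniteMeasure μ] :
    Integrable (fun x => (y.1 x : ℂ)) μ := by
  refine Integrable.of_bound (contAddChar.continuous_coe y).measurable.aestronglyMeasurable 1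
    (Filter.Eventually.of_forall fun x => ?_)
  rw [Circle.norm_coe]

/-- If the characteristic function has modulus one at a character, then this character is almost
surely constant. -/
lemma ae_eq_charFn_of_norm_eq_one {μ : Measure X} [IsProbabilityMeasure μ] {y : contAddChar X}
    (hy : ‖charFn μ y‖ = 1) : ∀ᵐ x ∂μ, (y.1 x : ℂ) = charFn μ y := by
  set c := charFn μ y with hc
  have hcc : starRingEnd ℂ c * c = 1 := by
    rw [mul_comm, Complex.mul_conj, Complex.normSq_eq_norm_sq, hy]; simp
  have hint : Integrable (fun x => starRingEnd ℂ c * (y.1 x : ℂ)) μ :=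
    (contAddChar.integrable y μ).const_mul _
  have hle : ∀ x, (starRingEnd ℂ c * (y.1 x : ℂ)).re ≤ 1 := fun x => by
    refine (Complex.re_le_norm _).trans_eq ?_
    rw [norm_mul, Complex.norm_conj, hy, Circle.norm_coe, one_mul]
  have h0 : ∫ x, (1 - (starRingEnd ℂ c * (y.1 x : ℂ)).re) ∂μ = 0 := by
    have h1 : ∫ x, (starRingEnd ℂ c * (y.1 x : ℂ)).re ∂μ = 1 := by
      have := integral_re hint
      simp only [RCLike.re_eq_complex_re] at this
      rw [this, integral_const_mul]
      change (starRingEnd ℂ c * c).re = 1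
      rw [hcc, Complex.one_re]
    refine (integral_sub (integrable_const _) hint.re).trans ?_
    simp only [RCLike.re_eq_complex_re]
    rw [h1]; simp
  rw [integral_eq_zero_iff_of_nonneg (fun x => sub_nonneg.2 (hle x))
    ((integrable_const _).sub hint.re)] at h0
  filter_upwards [h0] with x hx
  have hx1 : (starRingEnd ℂ c * (y.1 x : ℂ)).re = 1 := by
    have : 1 - (starRingEnd ℂ c * (y.1 x : ℂ)).re = 0 := hx
    linarith
  have hx2 : starRingEnd ℂ c * (y.1 x : ℂ) = 1 := by
    have hn : Complex.normSq (starRingEnd ℂ c * (y.1 x : ℂ)) = 1 := by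
      rw [Complex.normSq_eq_norm_sq, norm_mul, Complex.norm_conj, hy, Circle.norm_coe]; norm_num
    rw [Complex.normSq_apply, hx1] at hn
    have him : (starRingEnd ℂ c * (y.1 x : ℂ)).im = 0 := by
      have : (starRingEnd ℂ c * (y.1 x : ℂ)).im * (starRingEnd ℂ c * (y.1 x : ℂ)).im = 0 := by
        linarith
      simpa only [mul_self_eq_zero] using this
    exact Complex.ext hx1 him
  calc (y.1 x : ℂ) = (starRingEnd ℂ c * (y.1 x : ℂ)) * c := by
        rw [mul_right_comm, hcc, one_mul]
    _ = c := by rw [hx2, one_mul]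

lemma eq_charFn_of_mem_support {μ : Measure X} [IsProbabilityMeasure μ] {y : contAddChar X}
    (hy : ‖charFn μ y‖ = 1) {x : X} (hx : x ∈ μ.support) : (y.1 x : ℂ) = charFn μ y :=
  Measure.support_subset_of_isClosed (t := {x | (y.1 x : ℂ) = charFn μ y})
    (isClosed_eq (contAddChar.continuous_coe y) continuous_const)
    (ae_eq_charFn_of_norm_eq_one hy) hx

lemma isCharLike_charFn (μ : Measure X) [IsProbabilityMeasure μ] : IsCharLike (charFn μ) where
  map_zero := charFn_zero μ
  norm_le_one := norm_charFn_le_one μ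
  norm_neg y := by rw [charFn_neg, Complex.norm_conj]
  map_add y e he := by
    have h := ae_eq_charFn_of_norm_eq_one he
    calc charFn μ (y + e) = ∫ x, (y.1 x : ℂ) * charFn μ e ∂μ := by
          refine integral_congr_ae ?_
          filter_upwards [h] with x hx
          rw [← hx]
          change ((y.1 x * e.1 x : Circle) : ℂ) = _
          rw [Circle.coe_mul]
      _ = charFn μ y * charFn μ e := integral_mul_const _ _

lemma charFn_conv [MeasurableAdd₂ X] (μ ν : Measure X) [IsFiniteMeasure μ] [IsFiniteMeasure ν]
    (y : contAddChar X) : charFn (μ.conv ν) y = charFn μ y * charFn ν y := by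
  unfold charFn
  rw [integral_conv (contAddChar.integrable y _), ← integral_mul_const]
  refine integral_congr_ae (Filter.Eventually.of_forall fun x => ?_)
  simp only [AddChar.map_add_eq_mul, Circle.coe_mul]
  exact integral_const_mul _ _

lemma charFn_dirac (x : X) (y : contAddChar X) : charFn (Measure.dirac x) y = y.1 x :=
  integral_dirac' _ _ (contAddChar.continuous_coe y).measurable.stronglyMeasurable

lemma charFn_map {Ω : Type*} [MeasurableSpace Ω] {P : Measure Ω} {ξ : Ω → X}
    (hξ : AEMeasurable ξ P) (y : contAddChar X) :
    charFn (P.map ξ) y = ∫ ω, (y.1 (ξ ω) : ℂ) ∂P :=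
  integral_map hξ (contAddChar.continuous_coe y).measurable.aestronglyMeasurable

variable [IsTopologicalAddGroup X] [CompactSpace X] [T2Space X] [TotallyDisconnectedSpace X]
  [SecondCountableTopology X]

/-- A distribution on a profinite abelian group is determined by its characteristic function. -/
theorem Measure.ext_of_charFn {μ ν : Measure X} [IsFiniteMeasure μ] [IsFiniteMeasure ν]
    (h : charFn μ = charFn ν) : μ = ν := by
  let M : Submonoid (BoundedContinuousFunction X ℂ) := MonoidHom.mrange contAddChar.toBCF
  let A : StarSubalgebra ℂ (BoundedContinuousFunction X ℂ) :=
    { toSubalgebra := Algebra.adjoin ℂ (M : Set (BoundedContinuousFunction X ℂ))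
      star_mem' := by
        intro a ha
        change a ∈ Algebra.adjoin ℂ _ at ha
        change star a ∈ Algebra.adjoin ℂ _
        induction ha using Algebra.adjoin_induction with
        | mem x hx =>
          obtain ⟨y, rfl⟩ := hx
          refine Algebra.subset_adjoin ⟨y⁻¹, ?_⟩
          ext x
          change ((y.toAdd.1 (-x) : Circle) : ℂ) = starRingEnd ℂ (y.toAdd.1 x : ℂ)
          rw [AddChar.map_neg_eq_inv, Circle.coe_inv_eq_conj]
        | algebraMap r =>
          rw [← algebraMap_star_comm]
          exact Subalgebra.algebraMap_mem _ _
        | add x y _ _ hx hy => rw [star_add]; exact add_mem hx hy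
        | mul x y _ _ hx hy => rw [star_mul]; exact mul_mem hy hx }
  let _ := TopologicalSpace.metrizableSpaceMetric X
  refine ext_of_forall_mem_subalgebra_integral_eq_of_pseudoEMetric_complete_countable (𝕜 := ℂ)
    (A := A) ?_ ?_
  · intro x x' hx
    obtain ⟨y, hy⟩ := exists_contAddChar_ne hx
    refine ⟨fun x => (y.1 x : ℂ), ⟨_, ⟨contAddChar.toBCF (Multiplicative.ofAdd y),
      Algebra.subset_adjoin ⟨_, rfl⟩, rfl⟩, rfl⟩, ?_⟩
    exact fun h => hy (Circle.coe_injective h)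
  · intro g hg
    change g ∈ Subalgebra.toSubmodule
      (Algebra.adjoin ℂ (M : Set (BoundedContinuousFunction X ℂ))) at hg
    rw [Algebra.adjoin_eq_span, Submonoid.closure_eq] at hg
    induction hg using Submodule.span_induction with
    | mem x hx =>
      obtain ⟨y, rfl⟩ := hx
      exact congrFun h y.toAdd
    | zero => simp
    | add x y _ _ hx hy =>
      simp only [BoundedContinuousFunction.coe_add, Pi.add_apply]
      rw [integral_add (x.integrable μ) (y.integrable μ), integral_add (x.integrable ν)
        (y.integrable ν), hx, hy]
    | smul a x _ hx =>
      simp only [BoundedContinuousFunction.coe_smul]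
      rw [integral_smul, integral_smul, hx]

end CharFn

section Structure

/-- Every element is a limit of integer multiples of `g`, with multiples that are determined
modulo powers of `p`. -/
def IsPowGenerator {A : Type*} [AddCommGroup A] [TopologicalSpace A] (p : ℕ) (g : A) : Prop :=
  ∀ x : A, ∀ U ∈ nhds x, ∃ k m : ℕ, ∀ n : ℕ, n ≡ m [MOD p ^ k] → n • g ∈ U

lemma PadicInt.isPowGenerator_one (p : ℕ) [Fact p.Prime] : IsPowGenerator p (1 : ℤ_[p]) := by
  intro x U hU
  obtain ⟨ε, hε, hεU⟩ := Metric.mem_nhds_iff.1 hU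
  obtain ⟨k, hk⟩ := PadicInt.exists_pow_neg_lt p hε
  refine ⟨k, x.appr k, fun n hn => hεU ?_⟩
  rw [Metric.mem_ball, dist_comm, dist_eq_norm, nsmul_one]
  refine lt_of_le_of_lt ?_ hk
  rw [PadicInt.norm_le_pow_iff_mem_span_pow,
    show x - (n : ℤ_[p]) = (x - (x.appr k : ℕ)) + ((x.appr k : ℕ) - (n : ℤ_[p])) by ring]
  refine Ideal.add_mem _ (PadicInt.appr_spec k x) ?_
  obtain ⟨c, hc⟩ := (Nat.modEq_iff_dvd.1 hn)
  rw [Ideal.mem_span_singleton]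
  exact ⟨c, by exact_mod_cast congrArg (Int.cast : ℤ → ℤ_[p]) hc⟩

lemma ZMod.isPowGenerator_one (p k : ℕ) [NeZero (p ^ k)] :
    IsPowGenerator p (1 : ZMod (p ^ k)) := by
  intro x U hU
  refine ⟨k, x.val, fun n hn => ?_⟩
  rw [nsmul_one, (ZMod.natCast_eq_natCast_iff _ _ _).2 hn, ZMod.natCast_zmod_val]
  exact mem_of_mem_nhds hU

lemma IsPowGenerator.map {A B : Type*} [AddCommGroup A] [TopologicalSpace A] [AddCommGroup B]
    [TopologicalSpace B] {p : ℕ} {g : A} (h : IsPowGenerator p g) (e : A ≃ₜ+ B) :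
    IsPowGenerator p (e g) := by
  intro x U hU
  have hU' : e ⁻¹' U ∈ nhds (e.symm x) := by
    refine e.continuous.continuousAt.preimage_mem_nhds ?_
    exact (e.apply_symm_apply x).symm ▸ hU
  obtain ⟨k, m, hkm⟩ := h _ _ hU'
  refine ⟨k, m, fun n hn => ?_⟩
  rw [← map_nsmul]
  exact hkm n hn

namespace IsCyclicOrPadic

variable {p : ℕ} [Fact p.Prime] {A : Type*} [AddCommGroup A] [TopologicalSpace A]

lemma neZero_pow (p k : ℕ) [Fact p.Prime] : NeZero (p ^ k) :=
  ⟨pow_ne_zero _ (Fact.out : p.Prime).ne_zero⟩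

lemma compactSpace (h : IsCyclicOrPadic p A) : CompactSpace A := by
  obtain ⟨k, ⟨e⟩⟩ | ⟨⟨e⟩⟩ := h
  · have := neZero_pow p k
    exact e.symm.toHomeomorph.compactSpace
  · exact e.symm.toHomeomorph.compactSpace

lemma t2Space (h : IsCyclicOrPadic p A) : T2Space A := by
  obtain ⟨k, ⟨e⟩⟩ | ⟨⟨e⟩⟩ := h
  · exact e.symm.toHomeomorph.t2Space
  · exact e.symm.toHomeomorph.t2Space

lemma totallyDisconnectedSpace (h : IsCyclicOrPadic p A) : TotallyDisconnectedSpace A := by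
  obtain ⟨k, ⟨e⟩⟩ | ⟨⟨e⟩⟩ := h
  · exact e.symm.toHomeomorph.totallyDisconnectedSpace
  · exact e.symm.toHomeomorph.totallyDisconnectedSpace

lemma secondCountableTopology (h : IsCyclicOrPadic p A) : SecondCountableTopology A := by
  obtain ⟨k, ⟨e⟩⟩ | ⟨⟨e⟩⟩ := h
  · have := neZero_pow p k
    exact e.toHomeomorph.secondCountableTopology
  · exact e.toHomeomorph.secondCountableTopology

lemma exists_isPowGenerator (h : IsCyclicOrPadic p A) : ∃ g : A, IsPowGenerator p g := by
  obtain ⟨k, ⟨e⟩⟩ | ⟨⟨e⟩⟩ := h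
  · have := neZero_pow p k
    exact ⟨_, (ZMod.isPowGenerator_one p k).map e.symm⟩
  · exact ⟨_, (PadicInt.isPowGenerator_one p).map e.symm⟩

lemma exists_two_nsmul_eq (h : IsCyclicOrPadic p A) (hp : p ≠ 2) (x : A) :
    ∃ x', 2 • x' = x := by
  have hcop : Nat.Coprime p 2 := (Nat.coprime_primes Fact.out Nat.prime_two).2 hp
  obtain ⟨k, ⟨e⟩⟩ | ⟨⟨e⟩⟩ := h
  · have hu : ((2 : ℕ) : ZMod (p ^ k)) * ((2 : ℕ) : ZMod (p ^ k))⁻¹ = 1 :=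
      ZMod.coe_mul_inv_eq_one 2 (hcop.symm.pow_right k)
    refine ⟨e.symm (((2 : ℕ) : ZMod (p ^ k))⁻¹ * e x), ?_⟩
    rw [← map_nsmul, nsmul_eq_mul, ← mul_assoc, hu, one_mul, ContinuousAddEquiv.symm_apply_apply]
  · have hu : IsUnit ((2 : ℕ) : ℤ_[p]) := by
      rwa [PadicInt.isUnit_iff, PadicInt.norm_natCast_eq_one_iff]
    obtain ⟨b, hb⟩ := hu.exists_right_inv
    refine ⟨e.symm (b * e x), ?_⟩
    rw [← map_nsmul, nsmul_eq_mul, ← mul_assoc, hb, one_mul, ContinuousAddEquiv.symm_apply_apply]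

end IsCyclicOrPadic

lemma dense_zmultiples_pi {Ps : Set ℕ} [hPs : ∀ p : Ps, Fact (p : ℕ).Prime] {F : Ps → Type*}
    [∀ p, AddCommGroup (F p)] [∀ p, TopologicalSpace (F p)] {g : ∀ p, F p}
    (hg : ∀ p : Ps, IsPowGenerator (p : ℕ) (g p)) :
    Dense (AddSubgroup.zmultiples g : Set (∀ p, F p)) := by
  intro x
  rw [mem_closure_iff_nhds]
  intro U hU
  rw [nhds_pi, Filter.mem_pi] at hU
  obtain ⟨I, hI, V, hV, hVU⟩ := hU
  choose k m hkm using fun p => hg p (x p) (V p) (hV p)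
  have hcop : ((hI.toFinset : Finset Ps) : Set Ps).Pairwise
      (Function.onFun Nat.Coprime fun p : Ps => (p : ℕ) ^ k p) := by
    intro p _ q _ hpq
    refine Nat.Coprime.pow _ _ ((Nat.coprime_primes (hPs p).out (hPs q).out).2 ?_)
    exact fun h => hpq (Subtype.ext h)
  obtain ⟨n, hn⟩ := Nat.chineseRemainderOfFinset m (fun p : Ps => (p : ℕ) ^ k p) hI.toFinset
    (fun p _ => pow_ne_zero _ (hPs p).out.ne_zero) hcop
  refine ⟨n • g, hVU fun p hp => ?_, AddSubgroup.nsmul_mem_zmultiples g n⟩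
  exact hkm p n (hn p (hI.mem_toFinset.2 hp))

end Structure

section Main

/-- Heyde's functional equation is preserved by shifts by `-x₁` and `α⁻¹ x₁`. -/
lemma HeydeEq.shift {X : Type*} [AddCommGroup X] [TopologicalSpace X] {α : X ≃ₜ+ X} {f g : contAddChar X → ℂ}
    (h : HeydeEq (contAddChar.congr α) f g) (x : X) :
    HeydeEq (contAddChar.congr α) (fun y => f y * y.1 (-x)) (fun y => g y * y.1 (α.symm x)) := by
  intro u v
  have e₁ : (((u + v).1 (-x) : Circle) : ℂ) * ((u + contAddChar.congr α v).1 (α.symm x) : Circle) =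
      (u.1 (-x) : ℂ) * u.1 (α.symm x) := by
    change ((u.1 (-x) * v.1 (-x) : Circle) : ℂ) *
      (u.1 (α.symm x) * v.1 (α (α.symm x)) : Circle) = _
    rw [ContinuousAddEquiv.apply_symm_apply, ← Circle.coe_mul, ← Circle.coe_mul,
      AddChar.map_neg_eq_inv v.1, mul_mul_mul_comm, inv_mul_cancel, mul_one]
  have e₂ : (((u - v).1 (-x) : Circle) : ℂ) * ((u - contAddChar.congr α v).1 (α.symm x) : Circle) =
      (u.1 (-x) : ℂ) * u.1 (α.symm x) := by
    rw [sub_eq_add_neg, sub_eq_add_neg]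
    change ((u.1 (-x) * v.1 (- -x) : Circle) : ℂ) *
      (u.1 (α.symm x) * v.1 (α (-α.symm x)) : Circle) = _
    rw [map_neg α, ContinuousAddEquiv.apply_symm_apply, ← Circle.coe_mul, ← Circle.coe_mul,
      neg_neg, AddChar.map_neg_eq_inv v.1, mul_mul_mul_comm, mul_inv_cancel, mul_one]
  calc _ = (f (u + v) * g (u + contAddChar.congr α v)) * ((((u + v).1 (-x) : Circle) : ℂ) *
        ((u + contAddChar.congr α v).1 (α.symm x) : Circle)) := mul_mul_mul_comm _ _ _ _
    _ = (f (u - v) * g (u - contAddChar.congr α v)) * ((((u - v).1 (-x) : Circle) : ℂ) *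
        ((u - contAddChar.congr α v).1 (α.symm x) : Circle)) := by rw [e₁, e₂, h u v]
    _ = _ := (mul_mul_mul_comm _ _ _ _).symm

variable {X : Type*} [AddCommGroup X] [TopologicalSpace X] [MeasurableSpace X] [BorelSpace X]

/-- The joint characteristic function of `ξ₁ + ξ₂` and `ξ₁ + α ξ₂`. -/
lemma integral_contAddChar_mul {Ω : Type*} [MeasurableSpace Ω] {P : Measure Ω}
    [IsProbabilityMeasure P] {ξ₁ ξ₂ : Ω → X} (hξ₁ : Measurable ξ₁) (hξ₂ : Measurable ξ₂)
    (hind : IndepFun ξ₁ ξ₂ P) (α : X ≃ₜ+ X) (u v : contAddChar X) :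
    ∫ ω, (u.1 (ξ₁ ω + ξ₂ ω) : ℂ) * v.1 (ξ₁ ω + α (ξ₂ ω)) ∂P =
      charFn (P.map ξ₁) (u + v) * charFn (P.map ξ₂) (u + contAddChar.congr α v) := by
  rw [charFn_map hξ₁.aemeasurable, charFn_map hξ₂.aemeasurable,
    ← hind.integral_fun_comp_mul_comp hξ₁.aemeasurable hξ₂.aemeasurable
      (contAddChar.continuous_coe _).measurable.aestronglyMeasurable
      (contAddChar.continuous_coe _).measurable.aestronglyMeasurable]
  refine integral_congr_ae (Filter.Eventually.of_forall fun ω => ?_)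
  change (u.1 (ξ₁ ω + ξ₂ ω) : ℂ) * v.1 (ξ₁ ω + α (ξ₂ ω)) =
    ((u.1 (ξ₁ ω) * v.1 (ξ₁ ω) : Circle) : ℂ) * ((u.1 (ξ₂ ω) * v.1 (α (ξ₂ ω)) : Circle) : ℂ)
  rw [AddChar.map_add_eq_mul, AddChar.map_add_eq_mul]
  simp only [Circle.coe_mul]
  ring

lemma integral_contAddChar_mul_neg {Ω : Type*} [MeasurableSpace Ω] {P : Measure Ω}
    [IsProbabilityMeasure P] {ξ₁ ξ₂ : Ω → X} (hξ₁ : Measurable ξ₁) (hξ₂ : Measurable ξ₂)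
    (hind : IndepFun ξ₁ ξ₂ P) (α : X ≃ₜ+ X) (u v : contAddChar X) :
    ∫ ω, (u.1 (ξ₁ ω + ξ₂ ω) : ℂ) * v.1 (-(ξ₁ ω + α (ξ₂ ω))) ∂P =
      charFn (P.map ξ₁) (u - v) * charFn (P.map ξ₂) (u - contAddChar.congr α v) := by
  rw [sub_eq_add_neg, sub_eq_add_neg, ← map_neg, ← integral_contAddChar_mul hξ₁ hξ₂ hind]
  rfl

lemma CondSymmetric.heydeEq {Ω : Type*} [MeasurableSpace Ω] {P : Measure Ω}
    [IsProbabilityMeasure P] {ξ₁ ξ₂ : Ω → X} (hξ₁ : Measurable ξ₁) (hξ₂ : Measurable ξ₂)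
    (hind : IndepFun ξ₁ ξ₂ P) {α : X ≃ₜ+ X}
    (h : CondSymmetric P (fun ω => ξ₁ ω + α (ξ₂ ω)) (fun ω => ξ₁ ω + ξ₂ ω)) :
    HeydeEq (contAddChar.congr α) (charFn (P.map ξ₁)) (charFn (P.map ξ₂)) := by
  intro u v
  rw [← integral_contAddChar_mul hξ₁ hξ₂ hind, ← integral_contAddChar_mul_neg hξ₁ hξ₂ hind]
  have hm : Measurable fun z : X × X => (u.1 z.1 : ℂ) * v.1 z.2 :=
    ((contAddChar.continuous_coe u).measurable.comp measurable_fst).mul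
      ((contAddChar.continuous_coe v).measurable.comp measurable_snd)
  have := congrArg (fun ν : Measure (X × X) => ∫ z, (u.1 z.1 : ℂ) * v.1 z.2 ∂ν) h.map_eq
  rwa [integral_map h.aemeasurable_fst hm.aestronglyMeasurable,
    integral_map h.aemeasurable_snd hm.aestronglyMeasurable] at this

variable [IsTopologicalAddGroup X]

lemma condSymmetric_of_coe {Ω : Type*} [MeasurableSpace Ω] {P : Measure Ω} {G : AddSubgroup X}
    (hG : IsClosed (G : Set X)) {η ξ : Ω → G} (hη : Measurable η) (hξ : Measurable ξ)
    (h : CondSymmetric P (fun ω => (η ω : X)) (fun ω => (ξ ω : X))) : CondSymmetric P η ξ := by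
  have m₁ : Measurable fun ω => (ξ ω, η ω) := hξ.prodMk hη
  have m₂ : Measurable fun ω => (ξ ω, -η ω) := hξ.prodMk hη.neg
  refine ⟨m₁.aemeasurable, m₂.aemeasurable, ?_⟩
  have he := MeasurableEmbedding.subtype_coe hG.measurableSet
  have hemb : MeasurableEmbedding (Prod.map (Subtype.val : G → X) (Subtype.val : G → X)) :=
    he.prodMap he
  rw [← hemb.comap_map (P.map fun ω => (ξ ω, η ω)), ← hemb.comap_map (P.map fun ω => (ξ ω, -η ω)),
    Measure.map_map hemb.measurable m₁, Measure.map_map hemb.measurable m₂]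
  exact congrArg _ h.map_eq

lemma isProbabilityMeasure_haarDistribution (K : AddSubgroup X) (hK : IsCompact (K : Set X)) :
    IsProbabilityMeasure (haarDistribution K hK) := by
  have : CompactSpace K := isCompact_iff_compactSpace.mp hK
  have : IsProbabilityMeasure
      (Measure.addHaarMeasure (⊤ : TopologicalSpace.PositiveCompacts K)) :=
    ⟨by simpa using Measure.addHaarMeasure_self (K₀ := (⊤ : TopologicalSpace.PositiveCompacts K))⟩
  exact Measure.isProbabilityMeasure_map measurable_subtype_coe.aemeasurable

lemma charFn_haarDistribution_eq_one {K : AddSubgroup X} (hK : IsCompact (K : Set X))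
    {y : contAddChar X} (hy : ∀ k ∈ K, y.1 k = 1) : charFn (haarDistribution K hK) y = 1 := by
  have : CompactSpace K := isCompact_iff_compactSpace.mp hK
  have := isProbabilityMeasure_haarDistribution K hK
  refine charFn_eq_of_ae ?_
  refine (ae_map_iff measurable_subtype_coe.aemeasurable ?_).2
    (Filter.Eventually.of_forall fun k => ?_)
  · exact (isClosed_eq (contAddChar.continuous_coe y) continuous_const).measurableSet
  · rw [hy k k.2, Circle.coe_one]

lemma charFn_haarDistribution_eq_zero {K : AddSubgroup X} (hK : IsCompact (K : Set X))
    {y : contAddChar X} {k : X} (hk : k ∈ K) (hy : y.1 k ≠ 1) :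
    charFn (haarDistribution K hK) y = 0 := by
  have : CompactSpace K := isCompact_iff_compactSpace.mp hK
  let m : Measure K := Measure.addHaarMeasure (⊤ : TopologicalSpace.PositiveCompacts K)
  have h₁ : charFn (haarDistribution K hK) y = ∫ z : K, (y.1 z : ℂ) ∂m :=
    charFn_map measurable_subtype_coe.aemeasurable y
  have h₂ : ∫ z : K, (y.1 z : ℂ) ∂m = (y.1 k : ℂ) * ∫ z : K, (y.1 z : ℂ) ∂m := by
    rw [← integral_const_mul, ← integral_add_left_eq_self (μ := m) _ (⟨k, hk⟩ : K)]
    refine integral_congr_ae (Filter.Eventually.of_forall fun z => ?_)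
    change ((y.1 (k + z) : Circle) : ℂ) = _
    rw [AddChar.map_add_eq_mul, Circle.coe_mul]
  rw [h₁]
  by_contra h0
  refine hy (Circle.coe_injective ?_)
  exact mul_right_cancel₀ h0 (h₂.symm.trans (one_mul _).symm)

variable [SecondCountableTopology X]

lemma HeydeEq.condSymmetric [CompactSpace X] [T2Space X] [TotallyDisconnectedSpace X]
    {Ω : Type*} [MeasurableSpace Ω] {P : Measure Ω}
    [IsProbabilityMeasure P] {ξ₁ ξ₂ : Ω → X} (hξ₁ : Measurable ξ₁) (hξ₂ : Measurable ξ₂)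
    (hind : IndepFun ξ₁ ξ₂ P) {α : X ≃ₜ+ X}
    (h : HeydeEq (contAddChar.congr α) (charFn (P.map ξ₁)) (charFn (P.map ξ₂))) :
    CondSymmetric P (fun ω => ξ₁ ω + α (ξ₂ ω)) (fun ω => ξ₁ ω + ξ₂ ω) := by
  have hα : Measurable α := α.continuous.measurable
  have m₁ : Measurable fun ω => (ξ₁ ω + ξ₂ ω, ξ₁ ω + α (ξ₂ ω)) :=
    (hξ₁.add hξ₂).prodMk (hξ₁.add (hα.comp hξ₂))
  have m₂ : Measurable fun ω => (ξ₁ ω + ξ₂ ω, -(ξ₁ ω + α (ξ₂ ω))) :=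
    (hξ₁.add hξ₂).prodMk (hξ₁.add (hα.comp hξ₂)).neg
  have := Measure.isProbabilityMeasure_map (μ := P) m₁.aemeasurable
  have := Measure.isProbabilityMeasure_map (μ := P) m₂.aemeasurable
  refine ⟨m₁.aemeasurable, m₂.aemeasurable, Measure.ext_of_charFn ?_⟩
  funext χ
  rw [charFn_map m₁.aemeasurable, charFn_map m₂.aemeasurable]
  let u := contAddChar.comap (AddMonoidHom.inl X X) (continuous_id.prodMk continuous_const) χ
  let v := contAddChar.comap (AddMonoidHom.inr X X) (continuous_const.prodMk continuous_id) χ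
  have hχ : ∀ a b, ((χ.1 (a, b) : Circle) : ℂ) = (u.1 a : ℂ) * v.1 b := fun a b => by
    change _ = ((χ.1 (a, 0) : Circle) : ℂ) * (χ.1 (0, b) : Circle)
    rw [← Circle.coe_mul, ← AddChar.map_add_eq_mul, Prod.mk_add_mk, add_zero, zero_add]
  simp only [hχ]
  rw [integral_contAddChar_mul hξ₁ hξ₂ hind, integral_contAddChar_mul_neg hξ₁ hξ₂ hind]
  exact h u v

lemma conv_dirac_neg_conv_dirac (μ : Measure X) [IsFiniteMeasure μ] (x : X) :
    (μ.conv (Measure.dirac (-x))).conv (Measure.dirac x) = μ := by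
  rw [Measure.conv_assoc, Measure.dirac_conv_dirac, neg_add_cancel, Measure.conv_dirac_zero]

end Main

/-- Heyde's theorem for a monothetic profinite abelian group on which multiplication by two is
surjective. -/
theorem exists_subgroup_of_condSymmetric
    {X : Type*} [AddCommGroup X] [TopologicalSpace X] [IsTopologicalAddGroup X]
    [MeasurableSpace X] [BorelSpace X] [CompactSpace X] [T2Space X] [TotallyDisconnectedSpace X]
    [SecondCountableTopology X] {x₀ : X} (hx₀ : Dense (AddSubgroup.zmultiples x₀ : Set X))
    (h2 : ∀ x : X, ∃ x', 2 • x' = x) (α : X ≃ₜ+ X)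
    {Ω : Type*} [MeasurableSpace Ω] (P : Measure Ω) [IsProbabilityMeasure P]
    (ξ₁ ξ₂ : Ω → X) (hξ₁ : Measurable ξ₁) (hξ₂ : Measurable ξ₂) (hind : IndepFun ξ₁ ξ₂ P)
    (μ₁ μ₂ : Measure X) (hμ₁ : P.map ξ₁ = μ₁) (hμ₂ : P.map ξ₂ = μ₂)
    (hsymm : CondSymmetric P (fun ω => ξ₁ ω + α (ξ₂ ω)) (fun ω => ξ₁ ω + ξ₂ ω)) :
    ∃ (G : AddSubgroup X) (lam : Measure X),
      IsCompact (G : Set X) ∧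
      G.map (AddMonoidHom.id X - (α : X →+ X)) = G ∧
      IsProbabilityMeasure lam ∧ lam (G : Set X)ᶜ = 0 ∧
      -- (i)
      (IsShift μ₁ lam ∧ IsShift μ₂ lam) ∧
      -- (ii)
      IsLeast {H : AddSubgroup X | IsClosed (H : Set X) ∧ lam.support ⊆ (H : Set X)} G ∧
      -- (iii)
      (∃ hK : IsCompact ((G.map (AddMonoidHom.id X + (α : X →+ X)) : AddSubgroup X) : Set X),
        IsFactor (haarDistribution (G.map (AddMonoidHom.id X + (α : X →+ X))) hK) lam) ∧
      -- (iv), where `αG` is the restriction of `α` to a topological automorphism of `G`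
      (∃ αG : G ≃ₜ+ G, (∀ g : G, (αG g : X) = α (g : X)) ∧
        ∀ {Ω' : Type*} [MeasurableSpace Ω'] (P' : Measure Ω') [IsProbabilityMeasure P']
          (η₁ η₂ : Ω' → G), Measurable η₁ → Measurable η₂ → IndepFun η₁ η₂ P' →
          P'.map (fun ω => (η₁ ω : X)) = lam → P'.map (fun ω => (η₂ ω : X)) = lam →
          CondSymmetric P' (fun ω => η₁ ω + αG (η₂ ω)) (fun ω => η₁ ω + η₂ ω)) := by
  have hp₁ : IsProbabilityMeasure μ₁ := hμ₁ ▸ Measure.isProbabilityMeasure_map hξ₁.aemeasurable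
  have hp₂ : IsProbabilityMeasure μ₂ := hμ₂ ▸ Measure.isProbabilityMeasure_map hξ₂.aemeasurable
  have htors := contAddChar.exists_odd_nsmul_eq_zero h2
  have hα := contAddChar.exists_congr_eq_zsmul hx₀ α
  have hα' := contAddChar.exists_congr_eq_zsmul hx₀ α.symm
  have heq := hsymm.heydeEq hξ₁ hξ₂ hind
  rw [hμ₁, hμ₂] at heq
  obtain ⟨x₁, hx₁⟩ := Measure.nonempty_support (IsProbabilityMeasure.ne_zero μ₁)
  set lam := μ₁.conv (Measure.dirac (-x₁)) with hlam
  set lam₂ := μ₂.conv (Measure.dirac (α.symm x₁)) with hlam₂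
  have hc₁ : charFn lam = fun y => charFn μ₁ y * y.1 (-x₁) := by
    funext y; rw [hlam, charFn_conv, charFn_dirac]
  have hc₂ : charFn lam₂ = fun y => charFn μ₂ y * y.1 (α.symm x₁) := by
    funext y; rw [hlam₂, charFn_conv, charFn_dirac]
  have heq' : HeydeEq (contAddChar.congr α) (charFn lam) (charFn lam₂) := by
    rw [hc₁, hc₂]; exact heq.shift x₁
  have hf := isCharLike_charFn lam
  have hf₂ := isCharLike_charFn lam₂
  set E := hf.unitSubgroup
  have hone : ∀ y ∈ E, charFn lam y = 1 := by
    intro y hy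
    have hy' : ‖charFn lam y‖ = 1 := hy
    rw [hc₁] at hy' ⊢
    simp only [norm_mul, Circle.norm_coe, mul_one] at hy' ⊢
    rw [← eq_charFn_of_mem_support hy' hx₁, ← Circle.coe_mul, ← AddChar.map_add_eq_mul,
      add_neg_cancel, AddChar.map_zero_eq_one, Circle.coe_one]
  have hcf : charFn lam = charFn lam₂ := heq'.eq_of_eq_one htors hα hα' hf hf₂ hone
  have hll : lam = lam₂ := Measure.ext_of_charFn hcf
  rw [← hcf] at heq'
  set G := contAddChar.annihilator E
  have hGclosed : IsClosed (G : Set X) := contAddChar.isClosed_annihilator E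
  have hsupp : lam.support ⊆ G := by
    intro x hx y hy
    refine Circle.coe_injective ?_
    rw [eq_charFn_of_mem_support hy hx, hone y hy, Circle.coe_one]
  have hGnull : lam (G : Set X)ᶜ = 0 :=
    measure_mono_null (Set.compl_subset_compl.2 hsupp) Measure.measure_compl_support
  have hmemE : ∀ y : contAddChar X, (∀ᵐ x ∂lam, y.1 x = 1) → y ∈ E := by
    intro y hy
    have : charFn lam y = 1 := charFn_eq_of_ae (hy.mono fun x hx => by rw [hx, Circle.coe_one])
    change ‖charFn lam y‖ = 1
    rw [this, norm_one]
  have hmemE' : ∀ y : contAddChar X, (∀ x ∈ G, y.1 x = 1) → y ∈ E := fun y hy =>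
    hmemE y (Filter.mem_of_superset Measure.support_mem_ae fun x hx => hy x (hsupp hx))
  have hαG : ∀ x ∈ G, α x ∈ G := fun x hx y hy => hx _ (apply_mem_of_mem hα hy)
  have hαG' : ∀ x ∈ G, α.symm x ∈ G := fun x hx y hy =>
    hx _ (apply_mem_of_mem (α := contAddChar.congr α.symm) hα' hy)
  have hclosed : ∀ φ : X →+ X, Continuous φ → IsCompact ((G.map φ : AddSubgroup X) : Set X) :=
    fun φ hφ => by
      rw [AddSubgroup.coe_map]
      exact hGclosed.isCompact.image hφ
  have hK := hclosed (AddMonoidHom.id X + (α : X →+ X)) (continuous_id.add α.continuous)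
  have hD := hclosed (AddMonoidHom.id X - (α : X →+ X)) (continuous_id.sub α.continuous)
  refine ⟨G, lam, hGclosed.isCompact, ?_, inferInstance, hGnull, ⟨⟨x₁, ?_⟩, ⟨-α.symm x₁, ?_⟩⟩,
    ⟨⟨hGclosed, hsupp⟩, ?_⟩, ⟨hK, lam, inferInstance, ?_⟩, ?_⟩
  · refine le_antisymm ?_ ?_
    · rintro _ ⟨x, hx, rfl⟩
      exact sub_mem hx (hαG x hx)
    · intro x hx
      by_contra hxD
      obtain ⟨y, hy, hyx⟩ := exists_contAddChar_ne_one hD.isClosed hxD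
      refine hyx (hx y (heq'.mem_of_sub_mem_right htors hf hf (hmemE' _ fun z hz => ?_)).1)
      have := hy _ ⟨z, hz, rfl⟩
      change y.1 (z - α z) = 1 at this
      rw [AddChar.map_sub_eq_div] at this
      rw [AddSubgroup.coe_sub, AddChar.sub_apply']
      exact this
  · exact (conv_dirac_neg_conv_dirac μ₁ x₁).symm
  · have := conv_dirac_neg_conv_dirac μ₂ (-α.symm x₁)
    rw [neg_neg] at this
    rw [hll]; exact this.symm
  · rintro H ⟨hH, hsH⟩ x hx
    by_contra hxH
    obtain ⟨y, hy, hyx⟩ := exists_contAddChar_ne_one hH hxH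
    refine hyx (hx y (hmemE y ?_))
    filter_upwards [Measure.support_mem_ae (μ := lam)] with z hz using hy z (hsH hz)
  · have := isProbabilityMeasure_haarDistribution _ hK
    refine Measure.ext_of_charFn ?_
    funext y
    rw [charFn_conv _ lam]
    by_cases hy : ∀ k ∈ G.map (AddMonoidHom.id X + (α : X →+ X)), y.1 k = 1
    · rw [charFn_haarDistribution_eq_one hK hy, one_mul]
    · push Not at hy
      obtain ⟨k, hk, hyk⟩ := hy
      rw [charFn_haarDistribution_eq_zero hK hk hyk, zero_mul]
      by_contra h0
      obtain ⟨x, hx, rfl⟩ := hk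
      refine hyk ?_
      have := hx _ (heq'.add_mem_of_left_ne_zero htors hα hα' hf hf h0)
      change y.1 (x + α x) = 1
      rw [AddChar.map_add_eq_mul]
      exact this
  · let αG : G ≃ₜ+ G :=
      { toFun := fun g => ⟨α g, hαG g g.2⟩
        invFun := fun g => ⟨α.symm g, hαG' g g.2⟩
        left_inv := fun g => Subtype.ext (α.symm_apply_apply g)
        right_inv := fun g => Subtype.ext (α.apply_symm_apply g)
        map_add' := fun a b => Subtype.ext (map_add α (a : X) b)
        continuous_toFun := (α.continuous.comp continuous_subtype_val).subtype_mk _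
        continuous_invFun := (α.symm.continuous.comp continuous_subtype_val).subtype_mk _ }
    refine ⟨αG, fun g => rfl, ?_⟩
    intro Ω' _ P' _ η₁ η₂ hη₁ hη₂ hη hl₁ hl₂
    have m₁ : Measurable fun ω => (η₁ ω : X) := measurable_subtype_coe.comp hη₁
    have m₂ : Measurable fun ω => (η₂ ω : X) := measurable_subtype_coe.comp hη₂
    have : SecondCountableTopology G := TopologicalSpace.Subtype.secondCountableTopology _
    have : BorelSpace G := Subtype.borelSpace _
    refine condSymmetric_of_coe hGclosed (hη₁.add ?_) (hη₁.add hη₂) ?_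
    · exact αG.continuous.measurable.comp hη₂
    · refine HeydeEq.condSymmetric m₁ m₂
        (hη.comp measurable_subtype_coe measurable_subtype_coe) (α := α) ?_
      rw [hl₁, hl₂]
      exact heq'

theorem theorem2p1
    -- the group `X`, the direct product of the groups `F p` over a set `Ps` of odd primes `p`
    {X : Type*} [AddCommGroup X] [TopologicalSpace X] [IsTopologicalAddGroup X]
    [MeasurableSpace X] [BorelSpace X]
    (Ps : Set ℕ) [∀ p : Ps, Fact (p : ℕ).Prime] (h2 : 2 ∉ Ps)
    (F : Ps → Type*) [∀ p, AddCommGroup (F p)] [∀ p, TopologicalSpace (F p)]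
    (hF : ∀ p : Ps, IsCyclicOrPadic (p : ℕ) (F p))
    (e : X ≃ₜ+ ((p : Ps) → F p))
    (α : X ≃ₜ+ X)
    -- the random variables `ξ₁`, `ξ₂` with distributions `μ₁`, `μ₂`
    {Ω : Type*} [MeasurableSpace Ω] (P : Measure Ω) [IsProbabilityMeasure P]
    (ξ₁ ξ₂ : Ω → X) (hξ₁ : Measurable ξ₁) (hξ₂ : Measurable ξ₂) (hind : IndepFun ξ₁ ξ₂ P)
    (μ₁ μ₂ : Measure X) (hμ₁ : P.map ξ₁ = μ₁) (hμ₂ : P.map ξ₂ = μ₂)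
    (hsymm : CondSymmetric P (fun ω => ξ₁ ω + α (ξ₂ ω)) (fun ω => ξ₁ ω + ξ₂ ω)) :
    ∃ (G : AddSubgroup X) (lam : Measure X),
      IsCompact (G : Set X) ∧
      G.map (AddMonoidHom.id X - (α : X →+ X)) = G ∧
      IsProbabilityMeasure lam ∧ lam (G : Set X)ᶜ = 0 ∧
      -- (i)
      (IsShift μ₁ lam ∧ IsShift μ₂ lam) ∧
      -- (ii)
      IsLeast {H : AddSubgroup X | IsClosed (H : Set X) ∧ lam.support ⊆ (H : Set X)} G ∧
      -- (iii)
      (∃ hK : IsCompact ((G.map (AddMonoidHom.id X + (α : X →+ X)) : AddSubgroup X) : Set X),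
        IsFactor (haarDistribution (G.map (AddMonoidHom.id X + (α : X →+ X))) hK) lam) ∧
      -- (iv), where `αG` is the restriction of `α` to a topological automorphism of `G`
      (∃ αG : G ≃ₜ+ G, (∀ g : G, (αG g : X) = α (g : X)) ∧
        ∀ {Ω' : Type*} [MeasurableSpace Ω'] (P' : Measure Ω') [IsProbabilityMeasure P']
          (η₁ η₂ : Ω' → G), Measurable η₁ → Measurable η₂ → IndepFun η₁ η₂ P' →
          P'.map (fun ω => (η₁ ω : X)) = lam → P'.map (fun ω => (η₂ ω : X)) = lam →
          CondSymmetric P' (fun ω => η₁ ω + αG (η₂ ω)) (fun ω => η₁ ω + η₂ ω)) := by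
  have hne2 : ∀ p : Ps, (p : ℕ) ≠ 2 := fun p hp => h2 (hp ▸ p.2)
  have := fun p => (hF p).compactSpace
  have := fun p => (hF p).t2Space
  have := fun p => (hF p).totallyDisconnectedSpace
  have := fun p => (hF p).secondCountableTopology
  have := e.symm.toHomeomorph.compactSpace
  have := e.symm.toHomeomorph.t2Space
  have := e.symm.toHomeomorph.totallyDisconnectedSpace
  have := e.toHomeomorph.secondCountableTopology
  choose g hg using fun p => (hF p).exists_isPowGenerator
  have hdense : Dense (AddSubgroup.zmultiples (e.symm g) : Set X) := by
    have := e.symm.toHomeomorph.surjective.denseRange.dense_image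
      e.symm.toHomeomorph.continuous (dense_zmultiples_pi hg)
    refine this.mono ?_
    rintro _ ⟨_, ⟨n, rfl⟩, rfl⟩
    exact ⟨n, (map_zsmul e.symm n g).symm⟩
  have htwo : ∀ x : X, ∃ x', 2 • x' = x := fun x => by
    choose z hz using fun p => (hF p).exists_two_nsmul_eq (hne2 p) (e x p)
    refine ⟨e.symm z, ?_⟩
    rw [← map_nsmul, show 2 • z = e x from funext hz, ContinuousAddEquiv.symm_apply_apply]
  exact exists_subgroup_of_condSymmetric hdense htwo α P ξ₁ ξ₂ hξ₁ hξ₂ hind μ₁ μ₂ hμ₁ hμ₂ hsymm
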